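/- **Setting.** For $n\ge 0$ let $E(n)=O(n)\ltimes\mathbb R^n$ be the Euclidean group with the subspace topology of $\mathbb R^{n\times n}\times\mathbb R^n$; for $g=(A,b)\in E(n)$ write $\mathrm{rot}(g)=A$ and $\mathrm{trans}(g)=b$, and call $g$ a translation if $A=I_n$. An $n$-dimensional space group is a discrete subgroup of $E(n)$ that contains $n$ linearly independent translations. Let $d_1,d_2\ge 0$, let $\mathcal S$ be a $d_2$-dimensional space group with subgroup of translations $T_{\mathcal S}$, and let $G$ be a discrete subgroup of $O(d_1)\oplus\mathcal S\subset E(d_1+d_2)$, where $A_1\oplus(A_2,b_2)=(\mathrm{diag}(A_1,A_2),(0,b_2))$, such that $\pi(G)=\mathcal S$ for the homomorphism $\pi(A\oplus g)=g$. Let $F=\ker(\pi|_G)$ and let $T\subset G$ be a subset that $\pi$ maps bijectively onto $T_{\mathcal S}$. Then $TF=\{tf: t\in T, f\in F\}$ is a normal subgroup of finite index of $G$. For $n\ge 1$ put $T^n=\{t^n:t\in T\}$, let $M_0$ be the set of all integers $n\ge1$ such that $T^n$ is a normal subgroup of $G$, and let $m\ge 1$ be the integer with $M_0=m\mathbb N$,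 $\mathbb N=\{1,2,\dots\}$. Representations are homomorphisms $\rho$ into finite-dimensional unitary groups $U(d_\rho)$, $d_\rho\ge1$; $\widehat H$ denotes the set of unitary equivalence classes of irreducible representations of $H$. For $k\in\mathbb R^{d_2}$ let $\chi_k(g)=\exp(2\pi i\langle k,\mathrm{trans}(\pi(g))\rangle)$, $g\in TF$. For $g\in G$ and $\rho\in\widehat{TF}$ let $(g\cdot\rho)(h)=\rho(g^{-1}hg)$. For $\rho,\rho'\in\widehat{TF}$ write $\rho\sim\rho'$ if $g\cdot\rho=\chi_k\rho'$ for some $g\in G$ and $k\in\mathbb R^{d_2}$; this is an equivalence relation. A representation set of $X/{\sim}$, for $X\subset\widehat{TF}$, is a subset of $X$ that contains exactly one element of each equivalence class of $\sim$ on $X$. Let $L=\mathrm{trans}(T_{\mathcal S})$, $L^*=\{x\in\mathbb R^{d_2}:\langle x,y\rangle\in\mathbb Z\text{ for all }y\in L\}$ and $L^*/N=\{k/N:k\in L^*\}$. **Statement.** (i) Let $R$ be a representation set of $\widehat{TF}/{\sim}$. For every $\sigma\in\widehat G$ there exist $\rho\in R$ and $k\in\mathbb R^{d_2}$ such that $\sigma$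 is a subrepresentation of $\mathrm{Ind}_{TF}^G(\chi_k\rho)$. (ii) Let $R$ be a representation set of $\{\rho\in\widehat{TF}:\rho|_{T^m}=I_{d_\rho}\}/{\sim}$. For every $N\in M_0$ and every $\sigma\in\widehat G$ with $\sigma|_{T^N}=I_{d_\sigma}$ there exist $\rho\in R$ and $k\in L^*/N$ such that $\sigma$ is a subrepresentation of $\mathrm{Ind}_{TF}^G(\chi_k\rho)$. -/

import Mathlib

open scoped Matrix

noncomputable section

/-! ### The Euclidean group -/

/-- The Euclidean group `O(n) ⋉ ℝⁿ` of the space `ℝⁿ` with coordinates indexed by a finite type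
`n`; the element with linear component `A` and translation component `b` acts by
`x ↦ A x + b`. -/
@[ext] structure EuclideanGroup (n : Type) [Fintype n] [DecidableEq n] where
  rot : Matrix.orthogonalGroup n ℝ
  trans : n → ℝ

namespace EuclideanGroup

variable {n : Type} [Fintype n] [DecidableEq n]

instance : Mul (EuclideanGroup n) :=
  ⟨fun g h => ⟨g.rot * h.rot, g.trans + g.rot.1 *ᵥ h.trans⟩⟩

instance : One (EuclideanGroup n) := ⟨⟨1, 0⟩⟩

instance : Inv (EuclideanGroup n) := ⟨fun g => ⟨g.rot⁻¹, -((g.rot⁻¹).1 *ᵥ g.trans)⟩⟩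

@[simp] theorem mul_rot (g h : EuclideanGroup n) : (g * h).rot = g.rot * h.rot := rfl

@[simp] theorem mul_trans (g h : EuclideanGroup n) :
    (g * h).trans = g.trans + g.rot.1 *ᵥ h.trans := rfl

@[simp] theorem one_rot : (1 : EuclideanGroup n).rot = 1 := rfl

@[simp] theorem one_trans : (1 : EuclideanGroup n).trans = 0 := rfl

@[simp] theorem inv_rot (g : EuclideanGroup n) : (g⁻¹).rot = g.rot⁻¹ := rfl

@[simp] theorem inv_trans (g : EuclideanGroup n) :
    (g⁻¹).trans = -((g.rot⁻¹).1 *ᵥ g.trans) := rfl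

instance : Group (EuclideanGroup n) :=
  Group.ofLeftAxioms
    (by
      intro a b c
      ext1
      · simp [mul_assoc]
      · simp [Matrix.mulVec_add, add_assoc])
    (by
      intro a
      ext1
      · simp
      · simp)
    (by
      intro a
      ext1
      · simp
      · simp)

/-- The subspace topology of `ℝ^(n × n) × ℝ^n`. -/
instance : TopologicalSpace (EuclideanGroup n) :=
  TopologicalSpace.induced
    (fun g => ((g.rot : Matrix n n ℝ), g.trans)) inferInstance

/-- The linear component as a group homomorphism. -/
def rotHom (n : Type) [Fintype n] [DecidableEq n] :
    EuclideanGroup n →* Matrix.orthogonalGroup n ℝ where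
  toFun g := g.rot
  map_one' := rfl
  map_mul' _ _ := rfl

/-- The group of all translations of `ℝⁿ`. -/
def translations (n : Type) [Fintype n] [DecidableEq n] : Subgroup (EuclideanGroup n) :=
  (rotHom n).ker

theorem mem_translations {g : EuclideanGroup n} : g ∈ translations n ↔ g.rot = 1 := Iff.rfl

end EuclideanGroup

/-- A space group: a discrete subgroup of the Euclidean group of `ℝⁿ` that contains `n` linearly
independent translations. -/
def IsSpaceGroup {n : Type} [Fintype n] [DecidableEq n] (S : Subgroup (EuclideanGroup n)) : Prop :=
  DiscreteTopology S ∧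
    ∃ t : n → EuclideanGroup n, (∀ i, t i ∈ S ⊓ EuclideanGroup.translations n) ∧
      LinearIndependent ℝ (fun i => (t i).trans)

/-- The homomorphism `O(d₁) × E(d₂) → E(d₁ + d₂)`,
`(A₁, (A₂, b₂)) ↦ (diag(A₁, A₂), (0, b₂))`; the coordinates of `ℝ^(d₁ + d₂)` are indexed by
`Fin d₁ ⊕ Fin d₂`. -/
def gplus (d₁ d₂ : ℕ) :
    Matrix.orthogonalGroup (Fin d₁) ℝ × EuclideanGroup (Fin d₂) →*
      EuclideanGroup (Fin d₁ ⊕ Fin d₂) where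
  toFun p :=
    { rot := ⟨Matrix.fromBlocks p.1.1 0 0 p.2.rot.1, by
        rw [Matrix.mem_orthogonalGroup_iff, Matrix.fromBlocks_transpose,
          Matrix.fromBlocks_multiply]
        have h1 := (Matrix.mem_orthogonalGroup_iff _ _).1 p.1.2
        have h2 := (Matrix.mem_orthogonalGroup_iff _ _).1 p.2.rot.2
        simp [h1, h2]⟩
      trans := Sum.elim 0 p.2.trans }
  map_one' := by
    ext1
    · apply Subtype.ext
      simp
    · ext i
      cases i <;> simp
  map_mul' p q := by
    ext1
    · apply Subtype.ext
      simp [Matrix.fromBlocks_multiply]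
    · ext i
      cases i <;> simp [Matrix.fromBlocks_mulVec]

theorem gplus_injective (d₁ d₂ : ℕ) : Function.Injective (gplus d₁ d₂) := by
  rintro ⟨A, g⟩ ⟨B, h⟩ e
  have e1 : Matrix.fromBlocks A.1 0 0 g.rot.1 = Matrix.fromBlocks B.1 0 0 h.rot.1 :=
    congrArg (fun x : EuclideanGroup (Fin d₁ ⊕ Fin d₂) => x.rot.1) e
  have e2 : (Sum.elim (0 : Fin d₁ → ℝ) g.trans : Fin d₁ ⊕ Fin d₂ → ℝ) =
      Sum.elim (0 : Fin d₁ → ℝ) h.trans :=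
    congrArg EuclideanGroup.trans e
  rw [Matrix.fromBlocks_inj] at e1
  refine Prod.ext (Subtype.ext e1.1) (EuclideanGroup.ext (Subtype.ext e1.2.2.2) ?_)
  funext i
  exact congrFun e2 (Sum.inr i)

/-- The natural surjective homomorphism `O(d₁) ⊕ E(d₂) → E(d₂)`, `A ⊕ g ↦ g`. -/
def blockProj (d₁ d₂ : ℕ) : (gplus d₁ d₂).range →* EuclideanGroup (Fin d₂) :=
  (MonoidHom.snd _ _).comp (MonoidHom.ofInjective (gplus_injective d₁ d₂)).symm.toMonoidHom

theorem blockProj_gplus {d₁ d₂ : ℕ}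
    (p : Matrix.orthogonalGroup (Fin d₁) ℝ × EuclideanGroup (Fin d₂)) :
    blockProj d₁ d₂ ⟨gplus d₁ d₂ p, p, rfl⟩ = p.2 := by
  have h : (⟨gplus d₁ d₂ p, p, rfl⟩ : (gplus d₁ d₂).range) =
      MonoidHom.ofInjective (gplus_injective d₁ d₂) p := rfl
  rw [h]
  simp [blockProj]

/-! ### Unitary representations, dual space and induced representations -/

/-- A (finite-dimensional, unitary) representation of `H`. -/
structure UnitaryRep (H : Type) [Group H] where
  dim : ℕ
  dim_pos : 0 < dim
  hom : H →* Matrix.unitaryGroup (Fin dim) ℂ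

namespace UnitaryRep

variable {H : Type} [Group H]

/-- `ρ(g)` as a matrix. -/
def mat (ρ : UnitaryRep H) (g : H) : Matrix (Fin ρ.dim) (Fin ρ.dim) ℂ := (ρ.hom g).1

theorem mat_mul (ρ : UnitaryRep H) (g h : H) : ρ.mat (g * h) = ρ.mat g * ρ.mat h := by
  simp [mat]

theorem mat_one (ρ : UnitaryRep H) : ρ.mat 1 = 1 := by
  simp [mat]

theorem mat_inv (ρ : UnitaryRep H) (g : H) : ρ.mat g⁻¹ = (ρ.mat g)ᴴ := by
  simp [mat, Matrix.star_eq_conjTranspose]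

/-- Unitary equivalence: `Tᴴ ρ(g) T = ρ'(g)` for all `g`, with `T` unitary. (The two equations
that express unitarity of `T` force the dimensions to agree.) -/
def Equivalent (ρ ρ' : UnitaryRep H) : Prop :=
  ∃ T : Matrix (Fin ρ.dim) (Fin ρ'.dim) ℂ, T * Tᴴ = 1 ∧ Tᴴ * T = 1 ∧
    ∀ g, Tᴴ * ρ.mat g * T = ρ'.mat g

theorem Equivalent.refl (ρ : UnitaryRep H) : Equivalent ρ ρ := ⟨1, by simp, by simp, by simp⟩

theorem Equivalent.symm {ρ ρ' : UnitaryRep H} (h : Equivalent ρ ρ') : Equivalent ρ' ρ := by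
  obtain ⟨T, h1, h2, h3⟩ := h
  refine ⟨Tᴴ, by simpa using h2, by simpa using h1, fun g => ?_⟩
  rw [← h3 g, Matrix.conjTranspose_conjTranspose]
  calc T * (Tᴴ * ρ.mat g * T) * Tᴴ = (T * Tᴴ) * ρ.mat g * (T * Tᴴ) := by
        simp only [Matrix.mul_assoc]
    _ = ρ.mat g := by simp [h1]

theorem Equivalent.trans {ρ₁ ρ₂ ρ₃ : UnitaryRep H} (h : Equivalent ρ₁ ρ₂)
    (h' : Equivalent ρ₂ ρ₃) : Equivalent ρ₁ ρ₃ := by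
  obtain ⟨T, h1, h2, h3⟩ := h
  obtain ⟨U, k1, k2, k3⟩ := h'
  refine ⟨T * U, ?_, ?_, fun g => ?_⟩
  · calc T * U * (T * U)ᴴ = T * (U * Uᴴ) * Tᴴ := by
          simp only [Matrix.conjTranspose_mul, Matrix.mul_assoc]
      _ = 1 := by simp [k1, h1]
  · calc (T * U)ᴴ * (T * U) = Uᴴ * (Tᴴ * T) * U := by
          simp only [Matrix.conjTranspose_mul, Matrix.mul_assoc]
      _ = 1 := by simp [k2, h2]
  · rw [← k3 g, ← h3 g]
    simp only [Matrix.conjTranspose_mul, Matrix.mul_assoc]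

instance setoid (H : Type) [Group H] : Setoid (UnitaryRep H) where
  r := Equivalent
  iseqv := ⟨Equivalent.refl, Equivalent.symm, Equivalent.trans⟩

/-- Irreducibility: the only invariant subspaces are `0` and the whole space. -/
def Irreducible (ρ : UnitaryRep H) : Prop :=
  ∀ W : Submodule ℂ (Fin ρ.dim → ℂ), (∀ g, ∀ w ∈ W, ρ.mat g *ᵥ w ∈ W) → W = ⊥ ∨ W = ⊤

theorem Equivalent.irreducible {ρ ρ' : UnitaryRep H} (h : Equivalent ρ ρ')
    (hρ : ρ.Irreducible) : ρ'.Irreducible := by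
  obtain ⟨T, h1, h2, h3⟩ := h
  intro W hW
  have key : ∀ g w, ρ'.mat g *ᵥ (Tᴴ *ᵥ w) = Tᴴ *ᵥ (ρ.mat g *ᵥ w) := by
    intro g w
    rw [← h3 g, Matrix.mulVec_mulVec, Matrix.mulVec_mulVec, Matrix.mul_assoc _ T, h1,
      Matrix.mul_one]
  have hs : ∀ w, Tᴴ *ᵥ (T *ᵥ w) = w := by
    intro w
    rw [Matrix.mulVec_mulVec, h2, Matrix.one_mulVec]
  rcases hρ (W.comap (Matrix.mulVecLin Tᴴ)) (by
    intro g w hw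
    have h4 := hW g _ hw
    simp only [Matrix.mulVecLin_apply] at h4
    rw [key] at h4
    simpa using h4) with h | h
  · left
    rw [Submodule.eq_bot_iff] at h ⊢
    intro w hw
    have h5 := h (T *ᵥ w) (by simpa [hs] using hw)
    rw [← hs w, h5, Matrix.mulVec_zero]
  · right
    rw [Submodule.eq_top_iff'] at h ⊢
    intro w
    have h6 := h (T *ᵥ w)
    simpa [hs] using h6

/-- `ρ` is trivial on the subset `X`, i.e. `ρ(x)` is the identity matrix for all `x ∈ X`. -/
def TrivialOn (ρ : UnitaryRep H) (X : Set H) : Prop := ∀ x ∈ X, ρ.mat x = 1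

theorem Equivalent.trivialOn {ρ ρ' : UnitaryRep H} (h : Equivalent ρ ρ') {X : Set H}
    (hρ : ρ.TrivialOn X) : ρ'.TrivialOn X := by
  obtain ⟨T, h1, h2, h3⟩ := h
  intro x hx
  rw [← h3, hρ x hx, Matrix.mul_one, h2]

/-- `σ` is a subrepresentation of `τ`: there is an isometric intertwiner, i.e. `σ` is unitarily
equivalent to the restriction of `τ` to an invariant subspace. -/
def IsSubrep (σ τ : UnitaryRep H) : Prop :=
  ∃ V : Matrix (Fin τ.dim) (Fin σ.dim) ℂ, Vᴴ * V = 1 ∧ ∀ g, τ.mat g * V = V * σ.mat g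

theorem IsSubrep.congr {σ σ' τ τ' : UnitaryRep H} (hσ : Equivalent σ σ')
    (hτ : Equivalent τ τ') (h : IsSubrep σ τ) : IsSubrep σ' τ' := by
  obtain ⟨A, a1, a2, a3⟩ := hσ
  obtain ⟨B, b1, b2, b3⟩ := hτ
  obtain ⟨V, v1, v2⟩ := h
  refine ⟨Bᴴ * V * A, ?_, fun g => ?_⟩
  · calc (Bᴴ * V * A)ᴴ * (Bᴴ * V * A) = Aᴴ * (Vᴴ * (B * Bᴴ) * V) * A := by
          simp only [Matrix.conjTranspose_mul, Matrix.conjTranspose_conjTranspose,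
            Matrix.mul_assoc]
      _ = 1 := by simp [b1, v1, a2]
  · rw [← b3 g, ← a3 g]
    calc Bᴴ * τ.mat g * B * (Bᴴ * V * A) = Bᴴ * τ.mat g * (B * Bᴴ) * V * A := by
          simp only [Matrix.mul_assoc]
      _ = Bᴴ * (τ.mat g * V) * A := by simp only [b1, Matrix.mul_one, Matrix.mul_assoc]
      _ = Bᴴ * V * (A * Aᴴ) * σ.mat g * A := by
          rw [v2, a1]; simp only [Matrix.mul_one, Matrix.mul_assoc]
      _ = Bᴴ * V * A * (Aᴴ * σ.mat g * A) := by simp only [Matrix.mul_assoc]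

/-- The product `χ ρ` of a (unitary) character `χ` and a representation `ρ`. -/
def twist (χ : H →* Circle) (ρ : UnitaryRep H) : UnitaryRep H where
  dim := ρ.dim
  dim_pos := ρ.dim_pos
  hom :=
    { toFun := fun g => ⟨(χ g : ℂ) • ρ.mat g, by
        rw [Matrix.mem_unitaryGroup_iff, star_smul, smul_mul_smul_comm]
        have h1 : (χ g : ℂ) * star (χ g : ℂ) = 1 := by
          have := Complex.mul_conj (χ g : ℂ)
          simpa [Circle.normSq_coe] using this
        have h2 : ρ.mat g * star (ρ.mat g) = 1 := Matrix.mem_unitaryGroup_iff.1 (ρ.hom g).2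
        rw [h1, h2, one_smul]⟩
      map_one' := by
        apply Subtype.ext
        simp [mat_one]
      map_mul' := fun g h => by
        apply Subtype.ext
        simp [mat_mul, smul_smul, mul_comm] }

theorem twist_mat (χ : H →* Circle) (ρ : UnitaryRep H) (g : H) :
    (twist χ ρ).mat g = (χ g : ℂ) • ρ.mat g := rfl

theorem Equivalent.twist (χ : H →* Circle) {ρ ρ' : UnitaryRep H} (h : Equivalent ρ ρ') :
    Equivalent (twist χ ρ) (twist χ ρ') := by
  obtain ⟨T, h1, h2, h3⟩ := h
  refine ⟨T, h1, h2, fun g => ?_⟩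
  change Tᴴ * ((χ g : ℂ) • ρ.mat g) * T = (χ g : ℂ) • ρ'.mat g
  rw [← h3 g]
  simp

/-- For a normal subgroup `K` of `H`, the action of `H` on the representations of `K`:
`(g · ρ)(x) = ρ(g⁻¹ x g)`. -/
def conj {K : Subgroup H} [K.Normal] (g : H) (ρ : UnitaryRep K) : UnitaryRep K where
  dim := ρ.dim
  dim_pos := ρ.dim_pos
  hom := ρ.hom.comp (MulAut.conjNormal g)⁻¹.toMonoidHom

theorem conj_mat {K : Subgroup H} [hK : K.Normal] (g : H) (ρ : UnitaryRep K) (x : K) :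
    (conj g ρ).mat x =
      ρ.mat ⟨g⁻¹ * x * g, by simpa using hK.conj_mem x x.2 g⁻¹⟩ := by
  have : ((MulAut.conjNormal g)⁻¹ : MulAut K) x =
      ⟨g⁻¹ * x * g, by simpa using hK.conj_mem x x.2 g⁻¹⟩ :=
    Subtype.ext (MulAut.conjNormal_inv_apply g x)
  rw [← this]
  rfl

theorem Equivalent.conj {K : Subgroup H} [K.Normal] (g : H) {ρ ρ' : UnitaryRep K}
    (h : Equivalent ρ ρ') : Equivalent (conj g ρ) (conj g ρ') := by
  obtain ⟨T, h1, h2, h3⟩ := h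
  exact ⟨T, h1, h2, fun x => h3 _⟩

open Classical in
/-- The extension `ρ̇` of `ρ` from the subgroup `K` to `H` by the zero matrix. -/
def dot {K : Subgroup H} (ρ : UnitaryRep K) (g : H) : Matrix (Fin ρ.dim) (Fin ρ.dim) ℂ :=
  if h : g ∈ K then ρ.mat ⟨g, h⟩ else 0

theorem dot_one {K : Subgroup H} (ρ : UnitaryRep K) : ρ.dot 1 = 1 := by
  rw [dot, dif_pos K.one_mem]
  exact ρ.mat_one

theorem dot_inv {K : Subgroup H} (ρ : UnitaryRep K) (g : H) : ρ.dot g⁻¹ = (ρ.dot g)ᴴ := by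
  by_cases h : g ∈ K
  · rw [dot, dot, dif_pos h, dif_pos (K.inv_mem h), ← mat_inv]
    rfl
  · rw [dot, dot, dif_neg h, dif_neg (fun h' => h (by simpa using K.inv_mem h'))]
    simp

theorem dot_mul {K : Subgroup H} (ρ : UnitaryRep K) {g h : H} (hh : h ∈ K) :
    ρ.dot (g * h) = ρ.dot g * ρ.dot h := by
  by_cases hg : g ∈ K
  · rw [dot, dot, dot, dif_pos hg, dif_pos hh, dif_pos (K.mul_mem hg hh), ← mat_mul]
    rfl
  · rw [dot, dot, dif_neg hg, dif_neg (fun h' => hg ((K.mul_mem_cancel_right hh).1 h'))]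
    simp

/-- A complete set of representatives `h₁, …, hₙ` of the left cosets of a subgroup `K` of finite
index. -/
def cosetRep (K : Subgroup H) [K.FiniteIndex] (i : Fin K.index) : H :=
  ((Finite.equivFin (H ⧸ K)).symm i).out

theorem cosetRep_bijective (K : Subgroup H) [K.FiniteIndex] :
    Function.Bijective (fun i => (QuotientGroup.mk (cosetRep K i) : H ⧸ K)) := by
  have : (fun i => (QuotientGroup.mk (cosetRep K i) : H ⧸ K)) =
      (Finite.equivFin (H ⧸ K)).symm := by
    funext i
    exact QuotientGroup.out_eq' _
  rw [this]
  exact Equiv.bijective _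

/-- The block matrix `(ρ̇(hᵢ⁻¹ g hⱼ))ᵢⱼ`. -/
def indBlock {K : Subgroup H} [K.FiniteIndex] (ρ : UnitaryRep K) (g : H) :
    Matrix (Fin K.index × Fin ρ.dim) (Fin K.index × Fin ρ.dim) ℂ :=
  Matrix.of fun p q => ρ.dot ((cosetRep K p.1)⁻¹ * g * cosetRep K q.1) p.2 q.2

theorem indBlock_one {K : Subgroup H} [K.FiniteIndex] (ρ : UnitaryRep K) :
    ρ.indBlock 1 = 1 := by
  ext ⟨i, a⟩ ⟨j, b⟩
  simp only [indBlock, Matrix.of_apply, mul_one]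
  by_cases h : i = j
  · subst h
    rw [inv_mul_cancel, dot_one]
    simp [Matrix.one_apply]
  · have : (cosetRep K i)⁻¹ * cosetRep K j ∉ K := fun h' =>
      h ((cosetRep_bijective K).1 (QuotientGroup.eq.2 h'))
    rw [dot, dif_neg this]
    simp [h]

theorem indBlock_mul {K : Subgroup H} [K.FiniteIndex] (ρ : UnitaryRep K) (g h : H) :
    ρ.indBlock (g * h) = ρ.indBlock g * ρ.indBlock h := by
  ext ⟨i, a⟩ ⟨l, c⟩
  rw [Matrix.mul_apply, Fintype.sum_prod_type]
  simp only [indBlock, Matrix.of_apply]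
  obtain ⟨j, hj⟩ := (cosetRep_bijective K).2 (QuotientGroup.mk (h * cosetRep K l))
  have hjK : (cosetRep K j)⁻¹ * h * cosetRep K l ∈ K := by
    rw [mul_assoc]
    exact QuotientGroup.eq.1 hj
  rw [Finset.sum_eq_single j]
  · rw [← Matrix.mul_apply, ← dot_mul ρ hjK]
    have e : (cosetRep K i)⁻¹ * (g * h) * cosetRep K l =
        (cosetRep K i)⁻¹ * g * cosetRep K j * ((cosetRep K j)⁻¹ * h * cosetRep K l) := by
      group
    rw [e]
  · intro j' _ hne
    have : (cosetRep K j')⁻¹ * h * cosetRep K l ∉ K := fun h' => hne (by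
      apply (cosetRep_bijective K).1
      rw [mul_assoc] at h'
      exact (QuotientGroup.eq.2 h').trans hj.symm)
    have h0 : ρ.dot ((cosetRep K j')⁻¹ * h * cosetRep K l) = 0 := dif_neg this
    simp [h0]
  · intro h'
    exact absurd (Finset.mem_univ _) h'

theorem indBlock_inv {K : Subgroup H} [K.FiniteIndex] (ρ : UnitaryRep K) (g : H) :
    ρ.indBlock g⁻¹ = (ρ.indBlock g)ᴴ := by
  ext ⟨i, a⟩ ⟨j, b⟩
  simp only [indBlock, Matrix.of_apply, Matrix.conjTranspose_apply]
  rw [← Matrix.conjTranspose_apply, ← dot_inv]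
  congr 2
  group

/-- The induced representation `Ind_K^H ρ : H → U(n d_ρ)`, where `n` is the index of `K`. -/
def ind {K : Subgroup H} [K.FiniteIndex] (ρ : UnitaryRep K) : UnitaryRep H where
  dim := K.index * ρ.dim
  dim_pos := Nat.mul_pos (Nat.pos_of_ne_zero Subgroup.FiniteIndex.index_ne_zero) ρ.dim_pos
  hom :=
    { toFun := fun g => ⟨Matrix.reindex finProdFinEquiv finProdFinEquiv (ρ.indBlock g), by
        rw [Matrix.mem_unitaryGroup_iff, Matrix.star_eq_conjTranspose,
          Matrix.conjTranspose_reindex, ← indBlock_inv, Matrix.reindex_apply,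
          Matrix.reindex_apply, Matrix.submatrix_mul_equiv, ← indBlock_mul, mul_inv_cancel,
          indBlock_one, Matrix.submatrix_one_equiv]⟩
      map_one' := by
        apply Subtype.ext
        simp [indBlock_one]
      map_mul' := fun g h => by
        apply Subtype.ext
        simp [indBlock_mul, Matrix.submatrix_mul_equiv] }

theorem ind_mat {K : Subgroup H} [K.FiniteIndex] (ρ : UnitaryRep K) (g : H) :
    ρ.ind.mat g = (ρ.indBlock g).submatrix finProdFinEquiv.symm finProdFinEquiv.symm := rfl

theorem dot_equivalent {K : Subgroup H} {ρ ρ' : UnitaryRep K}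
    {T : Matrix (Fin ρ.dim) (Fin ρ'.dim) ℂ} (h : ∀ g, Tᴴ * ρ.mat g * T = ρ'.mat g) (g : H) :
    Tᴴ * ρ.dot g * T = ρ'.dot g := by
  by_cases hg : g ∈ K
  · rw [dot, dot, dif_pos hg, dif_pos hg, h]
  · rw [dot, dot, dif_neg hg, dif_neg hg]
    simp

theorem Equivalent.ind {K : Subgroup H} [K.FiniteIndex] {ρ ρ' : UnitaryRep K}
    (h : Equivalent ρ ρ') : Equivalent ρ.ind ρ'.ind := by
  obtain ⟨T, h1, h2, h3⟩ := h
  let B : Matrix (Fin K.index × Fin ρ.dim) (Fin K.index × Fin ρ'.dim) ℂ :=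
    Matrix.kroneckerMap (· * ·) (1 : Matrix (Fin K.index) (Fin K.index) ℂ) T
  have hB : Bᴴ = Matrix.kroneckerMap (· * ·) (1 : Matrix (Fin K.index) (Fin K.index) ℂ) Tᴴ := by
    simp only [B]
    rw [Matrix.conjTranspose_kronecker, Matrix.conjTranspose_one]
  have hB1 : B * Bᴴ = 1 := by
    rw [hB, ← Matrix.mul_kronecker_mul, h1, Matrix.mul_one, Matrix.one_kronecker_one]
  have hB2 : Bᴴ * B = 1 := by
    rw [hB, ← Matrix.mul_kronecker_mul, h2, Matrix.mul_one, Matrix.one_kronecker_one]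
  have hB3 : ∀ g, Bᴴ * ρ.indBlock g * B = ρ'.indBlock g := by
    intro g
    ext ⟨i, a⟩ ⟨j, b⟩
    simp only [indBlock, Matrix.of_apply]
    rw [← dot_equivalent h3, hB]
    simp only [Matrix.mul_apply, Fintype.sum_prod_type, B, Matrix.kroneckerMap_apply,
      Matrix.of_apply, Matrix.one_apply, ite_mul, one_mul, zero_mul, mul_ite, mul_zero]
    simp
  let C : Matrix (Fin (K.index * ρ.dim)) (Fin (K.index * ρ'.dim)) ℂ :=
    B.submatrix finProdFinEquiv.symm finProdFinEquiv.symm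
  have hC : Cᴴ = Bᴴ.submatrix finProdFinEquiv.symm finProdFinEquiv.symm :=
    Matrix.conjTranspose_submatrix _ _ _
  have hC1 : C * Cᴴ = 1 := by
    rw [hC, Matrix.submatrix_mul_equiv, hB1, Matrix.submatrix_one_equiv]
  have hC2 : Cᴴ * C = 1 := by
    rw [hC, Matrix.submatrix_mul_equiv, hB2, Matrix.submatrix_one_equiv]
  have hC3 : ∀ g, Cᴴ * (ρ.indBlock g).submatrix finProdFinEquiv.symm finProdFinEquiv.symm * C =
      (ρ'.indBlock g).submatrix finProdFinEquiv.symm finProdFinEquiv.symm := by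
    intro g
    rw [hC, Matrix.submatrix_mul_equiv, Matrix.submatrix_mul_equiv, hB3]
  exact ⟨C, hC1, hC2, hC3⟩

end UnitaryRep

/-- Equivalence classes of representations of `H`. -/
abbrev RepClass (H : Type) [Group H] : Type := Quotient (UnitaryRep.setoid H)

namespace RepClass

variable {H : Type} [Group H]

/-- Irreducibility of an equivalence class of representations. -/
def Irreducible (c : RepClass H) : Prop :=
  Quotient.lift UnitaryRep.Irreducible
    (fun _ _ h => propext ⟨UnitaryRep.Equivalent.irreducible h, (UnitaryRep.Equivalent.symm h).irreducible⟩) c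

/-- The restriction of the class to the subset `X` is the identity. -/
def TrivialOn (c : RepClass H) (X : Set H) : Prop :=
  Quotient.lift (fun ρ : UnitaryRep H => ρ.TrivialOn X)
    (fun _ _ h => propext ⟨UnitaryRep.Equivalent.trivialOn h, (UnitaryRep.Equivalent.symm h).trivialOn⟩) c

/-- `c` is a subrepresentation of `c'`, for equivalence classes. -/
def IsSubrep (c c' : RepClass H) : Prop :=
  Quotient.lift₂ UnitaryRep.IsSubrep
    (fun _ _ _ _ h h' => propext ⟨UnitaryRep.IsSubrep.congr h h',
      UnitaryRep.IsSubrep.congr (UnitaryRep.Equivalent.symm h)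
        (UnitaryRep.Equivalent.symm h')⟩) c c'

/-- Multiplication of an equivalence class by a character. -/
def twist (χ : H →* Circle) : RepClass H → RepClass H :=
  Quotient.map (UnitaryRep.twist χ) (fun _ _ h => UnitaryRep.Equivalent.twist χ h)

/-- The action of `H` on the equivalence classes of representations of a normal subgroup. -/
def conj {K : Subgroup H} [K.Normal] (g : H) : RepClass K → RepClass K :=
  Quotient.map (UnitaryRep.conj g) (fun _ _ h => UnitaryRep.Equivalent.conj g h)

/-- The class of the induced representation. -/
def ind {K : Subgroup H} [K.FiniteIndex] : RepClass K → RepClass H :=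
  Quotient.map UnitaryRep.ind (fun _ _ h => UnitaryRep.Equivalent.ind h)

end RepClass

/-- The dual space of `H`: the set of all equivalence classes of irreducible representations. -/
def dualSpace (H : Type) [Group H] : Set (RepClass H) := {c | c.Irreducible}

/-- `R` is a representation set of `X/r`: it consists of elements of `X` and contains exactly one
element of every equivalence class. -/
def IsRepresentationSet {α : Type} (r : α → α → Prop) (X R : Set α) : Prop :=
  R ⊆ X ∧ ∀ x ∈ X, ∃! y, y ∈ R ∧ r x y

/-! ### The discrete group, its translational section and its wave vectors -/

/-- The setting: a `d₂`-dimensional space group `S`, a discrete group `G ≤ O(d₁) ⊕ S` whose image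
under the natural homomorphism `π` to `E(d₂)` is `S`, and a set `T ⊆ G` which `π` maps
bijectively onto the subgroup of translations of `S`. -/
structure SectionedGroup (d₁ d₂ : ℕ) where
  S : Subgroup (EuclideanGroup (Fin d₂))
  isSpaceGroup : IsSpaceGroup S
  G : Subgroup (EuclideanGroup (Fin d₁ ⊕ Fin d₂))
  discrete : DiscreteTopology G
  G_le : G ≤ (gplus d₁ d₂).range
  map_proj : ((blockProj d₁ d₂).comp (Subgroup.inclusion G_le)).range = S
  T : Set G
  bijOn : Set.BijOn ((blockProj d₁ d₂).comp (Subgroup.inclusion G_le)) T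
    ((S ⊓ EuclideanGroup.translations (Fin d₂) : Subgroup (EuclideanGroup (Fin d₂))) :
      Set (EuclideanGroup (Fin d₂)))

namespace SectionedGroup

variable {d₁ d₂ : ℕ} (D : SectionedGroup d₁ d₂)

/-- The homomorphism `π : G → E(d₂)`, whose image is `S`. -/
def proj : D.G →* EuclideanGroup (Fin d₂) :=
  (blockProj d₁ d₂).comp (Subgroup.inclusion D.G_le)

/-- The subgroup of translations of `S`. -/
def TS : Subgroup (EuclideanGroup (Fin d₂)) := D.S ⊓ EuclideanGroup.translations (Fin d₂)

/-- The kernel of `π` on `G`. -/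
def F : Subgroup D.G := D.proj.ker

theorem proj_mem (g : D.G) : D.proj g ∈ D.S := by
  rw [← D.map_proj]
  exact ⟨g, rfl⟩

open scoped Pointwise in
theorem mul_eq_comap : D.T * (D.F : Set D.G) = (D.TS.comap D.proj : Set D.G) := by
  ext g
  constructor
  · rintro ⟨t, ht, f, hf, rfl⟩
    have h1 : D.proj t ∈ D.TS := D.bijOn.mapsTo ht
    have h2 : D.proj f = 1 := hf
    simpa [h2] using h1
  · intro hg
    obtain ⟨t, ht, e⟩ := D.bijOn.surjOn hg
    refine ⟨t, ht, t⁻¹ * g, ?_, by simp⟩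
    change D.proj (t⁻¹ * g) = 1
    have e' : D.proj t = D.proj g := e
    rw [map_mul, map_inv, e', inv_mul_cancel]

open scoped Pointwise in
/-- The subgroup `T F` of `G`. -/
def TF : Subgroup D.G := (D.TS.comap D.proj).copy (D.T * (D.F : Set D.G)) D.mul_eq_comap

theorem TF_eq_comap : D.TF = D.TS.comap D.proj := Subgroup.copy_eq _ _ _

theorem TF_eq_ker : D.TF = ((EuclideanGroup.rotHom (Fin d₂)).comp D.proj).ker := by
  rw [TF_eq_comap]
  ext g
  exact ⟨fun h => h.2, fun h => ⟨D.proj_mem g, h⟩⟩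

instance : D.TF.Normal := by
  rw [TF_eq_ker]
  infer_instance

/-- The lattice `L` of the translation components of the translations of `S`. -/
def L : Set (Fin d₂ → ℝ) := EuclideanGroup.trans '' (D.TS : Set (EuclideanGroup (Fin d₂)))

/-- The dual lattice `L*`. -/
def Ldual : Set (Fin d₂ → ℝ) := {x | ∀ y ∈ D.L, ∃ z : ℤ, x ⬝ᵥ y = z}

/-- `L*/N = {k/N | k ∈ L*}`. -/
def LdualDiv (N : ℕ) : Set (Fin d₂ → ℝ) := (fun k => (N : ℝ)⁻¹ • k) '' D.Ldual

/-- The set `Tⁿ = {tⁿ | t ∈ T}` of all `n`-th powers of elements of `T`. -/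
def Tpow (n : ℕ) : Set D.G := (fun t => t ^ n) '' D.T

/-- The set of all positive integers `m` such that `T^m` is a normal subgroup of `G`. -/
def M₀ : Set ℕ := {m | 0 < m ∧ ∃ K : Subgroup D.G, K.Normal ∧ (K : Set D.G) = D.Tpow m}

/-- The character `χ_k(g) = exp(2πi ⟨k, trans(π(g))⟩)` of `T F`. -/
def chi (k : Fin d₂ → ℝ) : D.TF →* Circle where
  toFun g := Circle.exp (2 * Real.pi * (k ⬝ᵥ (D.proj g).trans))
  map_one' := by simp
  map_mul' g h := by
    have hg : (D.proj g).rot = 1 := by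
      have : (g : D.G) ∈ ((EuclideanGroup.rotHom (Fin d₂)).comp D.proj).ker :=
        D.TF_eq_ker ▸ g.2
      exact this
    rw [← Circle.exp_add, ← mul_add, ← dotProduct_add]
    simp [hg]

/-- The relation `ρ ∼ ρ'` on the dual space of `T F`: there are `g ∈ G` and `k ∈ ℝ^d₂` with
`g · ρ = χ_k ρ'`. -/
def Rel (ρ ρ' : RepClass D.TF) : Prop :=
  ∃ (g : D.G) (k : Fin d₂ → ℝ), RepClass.conj g ρ = RepClass.twist (D.chi k) ρ'

/-- The translation components form a discrete additive subgroup. -/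
def latticeSubgroup (S : Subgroup (EuclideanGroup (Fin d₂))) : AddSubgroup (Fin d₂ → ℝ) where
  carrier := {x | (⟨1, x⟩ : EuclideanGroup (Fin d₂)) ∈ S}
  zero_mem' := S.one_mem
  add_mem' {x y} hx hy := by
    have := S.mul_mem hx hy
    have e : (⟨1, x⟩ * ⟨1, y⟩ : EuclideanGroup (Fin d₂)) = ⟨1, x + y⟩ := by
      ext1 <;> simp
    rwa [e] at this
  neg_mem' {x} hx := by
    have := S.inv_mem hx
    have e : (⟨1, x⟩⁻¹ : EuclideanGroup (Fin d₂)) = ⟨1, -x⟩ := by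
      ext1 <;> simp
    rwa [e] at this

theorem latticeSubgroup_discrete {S : Subgroup (EuclideanGroup (Fin d₂))}
    (hS : DiscreteTopology S) : DiscreteTopology (latticeSubgroup S) := by
  let f : latticeSubgroup S → S := fun x => ⟨⟨1, x.1⟩, x.2⟩
  have hf : Continuous f := by
    refine Continuous.subtype_mk (continuous_induced_rng.2 ?_) _
    exact continuous_const.prodMk continuous_subtype_val
  refine DiscreteTopology.of_continuous_injective hf ?_
  intro x y h
  exact Subtype.ext (congrArg (fun z : S => z.1.trans) h)

theorem finite_pointGroup {S : Subgroup (EuclideanGroup (Fin d₂))} (hS : IsSpaceGroup S) :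
    {A : Matrix.orthogonalGroup (Fin d₂) ℝ | ∃ g ∈ S, g.rot = A}.Finite := by
  obtain ⟨hd, t, ht, hli⟩ := hS
  have := latticeSubgroup_discrete hd
  have hfin : ∀ c : ℝ,
      (Metric.closedBall (0 : Fin d₂ → ℝ) c ∩ (latticeSubgroup S : Set _)).Finite := fun c =>
    Metric.finite_isBounded_inter_isClosed DiscreteTopology.isDiscrete
      Metric.isBounded_closedBall AddSubgroup.isClosed_of_discrete
  let b := fun i => (t i).trans
  have hb : ∀ i, b i ∈ latticeSubgroup S := by
    intro i
    have h1 : (t i).rot = 1 := (ht i).2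
    have e : (⟨1, b i⟩ : EuclideanGroup (Fin d₂)) = t i := by
      ext1
      · exact h1.symm
      · rfl
    change (⟨1, b i⟩ : EuclideanGroup (Fin d₂)) ∈ S
    rw [e]
    exact (ht i).1
  have hspan : Submodule.span ℝ (Set.range b) = ⊤ :=
    hli.span_eq_top_of_card_eq_finrank' (by simp)
  let c : Fin d₂ → ℝ := fun i => Real.sqrt (b i ⬝ᵥ b i)
  refine Set.Finite.of_finite_image (f := fun A i => A.1 *ᵥ b i)
    ((Set.Finite.pi' (fun i => hfin (c i))).subset ?_) ?_
  · rintro _ ⟨A, ⟨g, hg, rfl⟩, rfl⟩ i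
    constructor
    · rw [mem_closedBall_zero_iff, pi_norm_le_iff_of_nonneg (Real.sqrt_nonneg _)]
      intro j
      apply Real.abs_le_sqrt
      have h1 : (g.rot.1 *ᵥ b i) ⬝ᵥ (g.rot.1 *ᵥ b i) = b i ⬝ᵥ b i := by
        have h2 := (Matrix.mem_orthogonalGroup_iff' _ _).1 g.rot.2
        rw [Matrix.dotProduct_mulVec, Matrix.vecMul_mulVec, h2, Matrix.vecMul_one]
      rw [← h1, sq]
      exact Finset.single_le_sum (f := fun j => (g.rot.1 *ᵥ b i) j * (g.rot.1 *ᵥ b i) j)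
        (fun j _ => mul_self_nonneg _) (Finset.mem_univ j)
    · have h3 := S.mul_mem (S.mul_mem hg (hb i)) (S.inv_mem hg)
      have e : g * ⟨1, b i⟩ * g⁻¹ = (⟨1, g.rot.1 *ᵥ b i⟩ : EuclideanGroup (Fin d₂)) := by
        ext1
        · simp
        · simp [Matrix.mulVec_neg, Matrix.mulVec_mulVec]
      rw [e] at h3
      exact h3
  · intro A _ B _ h
    apply Subtype.ext
    apply Matrix.mulVec_injective
    funext x
    have hx : x ∈ Submodule.span ℝ (Set.range b) := hspan ▸ Submodule.mem_top
    have := LinearMap.eqOn_span (R := ℝ) (f := A.1.mulVecLin) (g := B.1.mulVecLin)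
      (s := Set.range b) (by
        rintro _ ⟨i, rfl⟩
        exact congrFun h i) hx
    exact this

/-- `T F` has finite index in `G`, so that representations of `T F` can be induced to `G`. -/
instance : D.TF.FiniteIndex := by
  rw [TF_eq_ker]
  have : Finite ((EuclideanGroup.rotHom (Fin d₂)).comp D.proj).range := by
    refine Set.Finite.to_subtype ((finite_pointGroup D.isSpaceGroup).subset ?_)
    rintro _ ⟨g, rfl⟩
    exact ⟨D.proj g, D.proj_mem g, rfl⟩
  exact Subgroup.finiteIndex_ker _

end SectionedGroup

end

/-! The argument is Clifford theory for the normal subgroup `TF` together with Frobenius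
reciprocity. The restriction of `σ` to `TF` contains an irreducible `τ`. Some `ρ ∈ R` is related to
`τ`, so `g · τ = χ_k ρ` for some `g` and `k`. Since `σ` is defined on all of `G`, its restriction
contains every conjugate of `τ` (`IsSubrep.conj_res`), hence `χ_k ρ`; Frobenius reciprocity
(`Irreducible.isSubrep_ind`) then embeds `σ` in the representation induced by `χ_k ρ`. This is (i).

For (ii), `R` only meets the classes of representations trivial on `T^m`, so `τ` must first be moved
there. `T^m` is normal in `G` and `π` is injective on it, with image in a commutative group of
translations; so `T^m` is central in `TF`, and by Schur's lemma `τ` acts on it through a character.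
As `T^m` is a copy of the lattice `mL`, this character comes from a wave vector, and some `χ_l τ` is
trivial on `T^m` (`exists_twist_trivialOn`). Twisting does not change the class under `∼`
(`Rel.of_twist`), so the argument of (i) applies to the `ρ ∈ R` related to `χ_l τ`.

It remains to locate `k`. Since `m` divides `N`, `T^N ⊆ T^m` and `ρ` is trivial on `T^N`; so is `χ_k
ρ`, being contained in the restriction of `σ`. Hence `χ_k` is trivial on `T^N`, which says exactly
that `N k ∈ L*`. -/

namespace UnitaryRep

variable {H : Type} [Group H]

/-! ### Unitarity, restriction and subrepresentations -/

theorem mat_mul_conjTranspose (ρ : UnitaryRep H) (g : H) : ρ.mat g * (ρ.mat g)ᴴ = 1 := by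
  rw [← mat_inv, ← mat_mul, mul_inv_cancel, mat_one]

theorem conjTranspose_mul_mat (ρ : UnitaryRep H) (g : H) : (ρ.mat g)ᴴ * ρ.mat g = 1 := by
  rw [← mat_inv, ← mat_mul, inv_mul_cancel, mat_one]

theorem mat_inv_mul_mat (ρ : UnitaryRep H) (g : H) : ρ.mat g⁻¹ * ρ.mat g = 1 := by
  rw [← mat_mul, inv_mul_cancel, mat_one]

/-- A scalar is determined by the multiple of the identity of a nonempty size it gives. -/
theorem smul_one_injective (ρ : UnitaryRep H) :
    Function.Injective (fun c : ℂ => c • (1 : Matrix (Fin ρ.dim) (Fin ρ.dim) ℂ)) := by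
  intro c d h
  simpa using congrFun (congrFun h ⟨0, ρ.dim_pos⟩) ⟨0, ρ.dim_pos⟩

/-- Restriction of a representation to a subgroup. -/
def res (K : Subgroup H) (σ : UnitaryRep H) : UnitaryRep K where
  dim := σ.dim
  dim_pos := σ.dim_pos
  hom := σ.hom.comp K.subtype

theorem res_mat (K : Subgroup H) (σ : UnitaryRep H) (x : K) : (res K σ).mat x = σ.mat x := rfl

theorem IsSubrep.refl (σ : UnitaryRep H) : IsSubrep σ σ := ⟨1, by simp, by simp⟩

theorem IsSubrep.trans {ρ σ τ : UnitaryRep H} (h : IsSubrep ρ σ) (h' : IsSubrep σ τ) :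
    IsSubrep ρ τ := by
  obtain ⟨V, v1, v2⟩ := h
  obtain ⟨U, u1, u2⟩ := h'
  refine ⟨U * V, ?_, fun g => ?_⟩
  · calc (U * V)ᴴ * (U * V) = Vᴴ * (Uᴴ * U) * V := by
          simp only [Matrix.conjTranspose_mul, Matrix.mul_assoc]
      _ = 1 := by simp [u1, v1]
  · rw [← Matrix.mul_assoc, u2, Matrix.mul_assoc, v2, Matrix.mul_assoc]

theorem IsSubrep.trivialOn {σ τ : UnitaryRep H} (h : IsSubrep σ τ) {X : Set H}
    (hτ : τ.TrivialOn X) : σ.TrivialOn X := by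
  obtain ⟨V, v1, v2⟩ := h
  intro x hx
  calc σ.mat x = Vᴴ * V * σ.mat x := by rw [v1, Matrix.one_mul]
    _ = Vᴴ * (τ.mat x * V) := by rw [v2, Matrix.mul_assoc]
    _ = 1 := by rw [hτ x hx, Matrix.one_mul, v1]

/-- If `τ` is contained in the restriction of `σ` to a normal subgroup, then so is every
conjugate of `τ`. -/
theorem IsSubrep.conj_res {K : Subgroup H} [K.Normal] {σ : UnitaryRep H} {τ : UnitaryRep K}
    (h : IsSubrep τ (res K σ)) (g : H) : IsSubrep (conj g τ) (res K σ) := by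
  obtain ⟨V, v1, v2⟩ := h
  -- `(res K σ).dim` is `σ.dim` only by unfolding; the retyping lets products with `σ.mat g`
  -- elaborate.
  let U : Matrix (Fin σ.dim) (Fin τ.dim) ℂ := V
  have u1 : Uᴴ * U = 1 := v1
  have u2 (x : K) : σ.mat x * U = U * τ.mat x := v2 x
  -- The translate `σ(g) V` works because `σ(x) σ(g) = σ(g) σ(g⁻¹ x g)`.
  refine ⟨σ.mat g * U, ?_, fun x => ?_⟩
  · change (σ.mat g * U)ᴴ * (σ.mat g * U) = 1
    calc (σ.mat g * U)ᴴ * (σ.mat g * U) = Uᴴ * ((σ.mat g)ᴴ * σ.mat g) * U := by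
          simp only [Matrix.conjTranspose_mul, Matrix.mul_assoc]
      _ = 1 := by rw [conjTranspose_mul_mat, Matrix.mul_one, u1]
  · rw [conj_mat, res_mat]
    change σ.mat x * (σ.mat g * U) = σ.mat g * U * τ.mat _
    rw [Matrix.mul_assoc, ← u2, ← Matrix.mul_assoc, ← mat_mul, ← Matrix.mul_assoc, ← mat_mul]
    congr 2
    group

/-! ### Schur's lemma and irreducible subrepresentations -/

/-- Schur's lemma. -/
theorem Irreducible.eq_smul_one {ρ : UnitaryRep H} (hρ : ρ.Irreducible)
    {A : Matrix (Fin ρ.dim) (Fin ρ.dim) ℂ} (hA : ∀ g, A * ρ.mat g = ρ.mat g * A) :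
    ∃ c : ℂ, A = c • 1 := by
  have : Nonempty (Fin ρ.dim) := ⟨⟨0, ρ.dim_pos⟩⟩
  obtain ⟨c, hc⟩ := Module.End.exists_eigenvalue A.mulVecLin
  refine ⟨c, ?_⟩
  rcases hρ (Module.End.eigenspace A.mulVecLin c) (by
    intro g w hw
    rw [Module.End.mem_eigenspace_iff, Matrix.mulVecLin_apply] at hw ⊢
    rw [Matrix.mulVec_mulVec, hA, ← Matrix.mulVec_mulVec, hw, Matrix.mulVec_smul]) with h | h
  · exact absurd h hc
  · apply Matrix.mulVec_injective
    funext w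
    have hw : w ∈ Module.End.eigenspace A.mulVecLin c := h ▸ Submodule.mem_top
    rw [Module.End.mem_eigenspace_iff, Matrix.mulVecLin_apply] at hw
    rw [hw, Matrix.smul_mulVec, Matrix.one_mulVec]

/-- The matrix of an orthonormal basis of a subspace. -/
theorem exists_isometry_of_submodule {n : ℕ} (W : Submodule ℂ (Fin n → ℂ)) :
    ∃ V : Matrix (Fin n) (Fin (Module.finrank ℂ W)) ℂ, Vᴴ * V = 1 ∧
      (∀ u, V *ᵥ u ∈ W) ∧ ∀ w ∈ W, V *ᵥ (Vᴴ *ᵥ w) = w := by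
  -- `Fin n → ℂ` carries the sup norm, so the orthonormal basis is taken in `EuclideanSpace`.
  let e := (WithLp.linearEquiv 2 ℂ (Fin n → ℂ)).symm
  let W' : Submodule ℂ (EuclideanSpace ℂ (Fin n)) := W.map (e : (Fin n → ℂ) →ₗ[ℂ] _)
  have hfin : Module.finrank ℂ W' = Module.finrank ℂ W := LinearEquiv.finrank_map_eq e W
  let b := (stdOrthonormalBasis ℂ W').reindex (finCongr hfin)
  let V : Matrix (Fin n) (Fin (Module.finrank ℂ W)) ℂ :=
    Matrix.of fun i j => (b j : EuclideanSpace ℂ (Fin n)) i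
  have hbW : ∀ j, (fun i => V i j) ∈ W := by
    intro j
    obtain ⟨w, hw, h⟩ := Submodule.mem_map.1 (b j).2
    have : (fun i => V i j) = w := by
      funext i
      change (b j : EuclideanSpace ℂ (Fin n)) i = w i
      rw [← h]
      rfl
    rwa [this]
  have hV : Vᴴ * V = 1 := by
    ext i j
    have h1 := orthonormal_iff_ite.1 b.orthonormal i j
    rw [Matrix.one_apply, ← h1, Submodule.coe_inner, PiLp.inner_apply, Matrix.mul_apply]
    refine Finset.sum_congr rfl fun k _ => ?_
    simp [V, mul_comm]
  have hu : ∀ u, V *ᵥ u = ∑ j, u j • (fun i => V i j) := by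
    intro u
    funext i
    simp [Matrix.mulVec, dotProduct, mul_comm]
  refine ⟨V, hV, fun u => ?_, fun w hw => ?_⟩
  · rw [hu]
    exact W.sum_mem fun j _ => W.smul_mem _ (hbW j)
  · have hw' : e w ∈ W' := Submodule.mem_map_of_mem hw
    have h2 : w = V *ᵥ (fun j => b.repr ⟨e w, hw'⟩ j) := by
      have h3 := congrArg (fun x : W' => (x : EuclideanSpace ℂ (Fin n)))
        (b.sum_repr ⟨e w, hw'⟩)
      simp only [Submodule.coe_sum, Submodule.coe_smul] at h3
      funext i
      have h4 := congrArg (fun x : EuclideanSpace ℂ (Fin n) => x i) h3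
      rw [hu]
      simp only [WithLp.ofLp_sum, WithLp.ofLp_smul, Finset.sum_apply, Pi.smul_apply] at h4 ⊢
      exact h4.symm
    rw [h2, Matrix.mulVec_mulVec _ Vᴴ, hV, Matrix.one_mulVec]

/-- The restriction of a representation to a nonzero invariant subspace. -/
theorem exists_isSubrep_of_invariant (σ : UnitaryRep H) (W : Submodule ℂ (Fin σ.dim → ℂ))
    (hW : ∀ g, ∀ w ∈ W, σ.mat g *ᵥ w ∈ W) (h0 : W ≠ ⊥) :
    ∃ τ : UnitaryRep H, τ.dim = Module.finrank ℂ W ∧ IsSubrep τ σ := by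
  obtain ⟨V, v1, v2, v3⟩ := exists_isometry_of_submodule W
  -- `V Vᴴ` is the orthogonal projection onto `W`, hence is the identity on the image of `σ(g) V`,
  -- which lies in `W` by invariance.
  have hV : ∀ g, V * (Vᴴ * σ.mat g * V) = σ.mat g * V := by
    intro g
    apply Matrix.mulVec_injective
    funext u
    have := v3 _ (hW g _ (v2 u))
    simpa only [Matrix.mulVec_mulVec, Matrix.mul_assoc] using this
  have hmul : ∀ g h, Vᴴ * σ.mat (g * h) * V = (Vᴴ * σ.mat g * V) * (Vᴴ * σ.mat h * V) := by
    intro g h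
    rw [Matrix.mul_assoc (Vᴴ * σ.mat g), hV, mat_mul]
    simp only [Matrix.mul_assoc]
  have hone : Vᴴ * σ.mat 1 * V = 1 := by rw [mat_one, Matrix.mul_one, v1]
  refine ⟨{
    dim := Module.finrank ℂ W
    dim_pos := Nat.pos_of_ne_zero fun h => h0 (Submodule.finrank_eq_zero.1 h)
    hom := {
      toFun := fun g => ⟨Vᴴ * σ.mat g * V, by
        have h1 : star (Vᴴ * σ.mat g * V) = Vᴴ * σ.mat g⁻¹ * V := by
          rw [Matrix.star_eq_conjTranspose, mat_inv]
          simp only [Matrix.conjTranspose_mul, Matrix.conjTranspose_conjTranspose,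
            Matrix.mul_assoc]
        rw [Matrix.mem_unitaryGroup_iff, h1, ← hmul, mul_inv_cancel, hone]⟩
      map_one' := Subtype.ext hone
      map_mul' := fun g h => Subtype.ext (hmul g h) } }, rfl, V, v1, fun g => (hV g).symm⟩

/-- Induction on the dimension: a reducible representation has a proper nonzero invariant subspace,
on which the dimension is smaller but still positive. -/
theorem exists_irreducible_isSubrep (σ : UnitaryRep H) :
    ∃ τ : UnitaryRep H, τ.Irreducible ∧ IsSubrep τ σ := by
  induction hn : σ.dim using Nat.strong_induction_on generalizing σ with
  | _ n ih =>
    by_cases hσ : σ.Irreducible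
    · exact ⟨σ, hσ, IsSubrep.refl σ⟩
    · simp only [Irreducible, not_forall, not_or] at hσ
      obtain ⟨W, hW, h0, h1⟩ := hσ
      obtain ⟨τ, hd, hτ⟩ := exists_isSubrep_of_invariant σ W hW h0
      have hlt : τ.dim < n := by
        have := Submodule.finrank_lt h1
        rw [hd, ← hn]
        simpa using this
      obtain ⟨υ, h2, h3⟩ := ih _ hlt τ rfl
      exact ⟨υ, h2, h3.trans hτ⟩

/-! ### Frobenius reciprocity -/

/-- Frobenius reciprocity, for irreducible representations `σ`. -/
theorem Irreducible.isSubrep_ind {K : Subgroup H} [K.FiniteIndex] {σ : UnitaryRep H}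
    (hσ : σ.Irreducible) {ρ : UnitaryRep K} (h : IsSubrep ρ (res K σ)) :
    IsSubrep σ ρ.ind := by
  obtain ⟨V', v1', v2⟩ := h
  obtain ⟨V, rfl⟩ : ∃ V : Matrix (Fin σ.dim) (Fin ρ.dim) ℂ, V = V' := ⟨V', rfl⟩
  have v1 : Vᴴ * V = 1 := v1'
  have hV : ∀ x : K, Vᴴ * σ.mat x = ρ.mat x * Vᴴ := by
    intro x
    have h1 : σ.mat (x : H)⁻¹ * V = V * ρ.mat x⁻¹ := v2 x⁻¹
    have h2 := congrArg Matrix.conjTranspose h1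
    simpa [mat_inv] using h2
  -- The Frobenius adjoint of `Vᴴ`: `w ↦ (Vᴴ σ(hᵢ)⁻¹ w)ᵢ`. It intertwines `σ` with the induced
  -- representation, and only needs rescaling to become an isometry.
  let B : Matrix (Fin K.index × Fin ρ.dim) (Fin σ.dim) ℂ :=
    Matrix.of fun p b => (Vᴴ * σ.mat (cosetRep K p.1)⁻¹) p.2 b
  have hB : ∀ g, ρ.indBlock g * B = B * σ.mat g := by
    intro g
    ext ⟨i, a⟩ b
    rw [Matrix.mul_apply, Fintype.sum_prod_type]
    -- Row `i` of the block matrix has a single nonzero block, in the column `j` with `g⁻¹ hᵢ ∈ hⱼ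
    -- K`.
    obtain ⟨j, hj⟩ := (cosetRep_bijective K).2 (QuotientGroup.mk (g⁻¹ * cosetRep K i))
    have hjK : (cosetRep K i)⁻¹ * g * cosetRep K j ∈ K := by
      have := QuotientGroup.eq.1 hj.symm
      simpa [mul_assoc] using this
    rw [Finset.sum_eq_single j]
    · have h1 : ∑ c, ρ.indBlock g (i, a) (j, c) * B (j, c) b =
          (ρ.dot ((cosetRep K i)⁻¹ * g * cosetRep K j) *
            (Vᴴ * σ.mat (cosetRep K j)⁻¹)) a b := rfl
      have h2 : (B * σ.mat g) (i, a) b = (Vᴴ * σ.mat (cosetRep K i)⁻¹ * σ.mat g) a b := rfl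
      rw [h1, h2, dot, dif_pos hjK, ← Matrix.mul_assoc, ← hV, Matrix.mul_assoc, ← mat_mul,
        Matrix.mul_assoc, ← mat_mul]
      simp
    · intro j' _ hne
      have h0 : ρ.dot ((cosetRep K i)⁻¹ * g * cosetRep K j') = 0 := dif_neg fun h' => hne (by
        refine (cosetRep_bijective K).1 (Eq.trans ?_ hj.symm)
        refine (QuotientGroup.eq.2 ?_).symm
        simpa [mul_assoc] using h')
      exact Finset.sum_eq_zero fun c _ => by simp [indBlock, h0]
    · intro h'
      exact absurd (Finset.mem_univ _) h'
  have hB' : ∀ g, Bᴴ * ρ.indBlock g = σ.mat g * Bᴴ := by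
    intro g
    have h1 := congrArg Matrix.conjTranspose (hB g⁻¹)
    simpa [mat_inv, indBlock_inv] using h1
  obtain ⟨c, hc⟩ := hσ.eq_smul_one (A := Bᴴ * B) (by
    intro g
    rw [Matrix.mul_assoc, ← hB, ← Matrix.mul_assoc, hB', Matrix.mul_assoc])
  -- One vanishing block suffices for a contradiction: `σ(hᵢ)⁻¹` is invertible, so `V` would vanish,
  -- against `Vᴴ V = 1` in positive dimension.
  have hB0 : B ≠ 0 := by
    intro h0
    obtain ⟨i, hi⟩ := (cosetRep_bijective K).2 (QuotientGroup.mk 1)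
    have h1 : Vᴴ * σ.mat (cosetRep K i)⁻¹ = 0 := by
      ext a b
      exact congrFun (congrFun h0 (i, a)) b
    have h2 : Vᴴ = 0 := by
      rw [← Matrix.mul_one Vᴴ, ← mat_inv_mul_mat σ (cosetRep K i), ← Matrix.mul_assoc, h1,
        Matrix.zero_mul]
    rw [h2, Matrix.zero_mul] at v1
    exact zero_ne_one (smul_one_injective ρ (by simpa using v1))
  open scoped ComplexOrder in
  have hcpos : 0 < c := by
    have h1 := (Matrix.posSemidef_conjTranspose_mul_self B).diag_nonneg (i := ⟨0, σ.dim_pos⟩)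
    rw [hc] at h1
    refine lt_of_le_of_ne (by simpa using h1) fun h => hB0 ?_
    rw [← Matrix.conjTranspose_mul_self_eq_zero, hc, ← h, zero_smul]
  obtain ⟨r, hr0, hr⟩ : ∃ r : ℝ, 0 < r ∧ c = r := by
    rw [Complex.pos_iff] at hcpos
    exact ⟨c.re, hcpos.1, Complex.ext rfl (by simp [← hcpos.2])⟩
  -- `Bᴴ B = r • 1` with `r > 0`, so `r^(-1/2) B` is an isometry.
  let s : ℂ := ((Real.sqrt r)⁻¹ : ℝ)
  have hs : star s * s * c = 1 := by
    have h1 : (Real.sqrt r)⁻¹ * (Real.sqrt r)⁻¹ * r = 1 := by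
      rw [← mul_inv, Real.mul_self_sqrt hr0.le, inv_mul_cancel₀ hr0.ne']
    have h2 : star s = s := Complex.conj_ofReal _
    rw [h2, hr]
    simp only [s]
    exact_mod_cast h1
  let C : Matrix (Fin (K.index * ρ.dim)) (Fin σ.dim) ℂ := B.submatrix finProdFinEquiv.symm id
  have hC : Cᴴ = Bᴴ.submatrix id finProdFinEquiv.symm := Matrix.conjTranspose_submatrix _ _ _
  have hC1 : (s • C)ᴴ * (s • C) = 1 := by
    rw [Matrix.conjTranspose_smul, Matrix.smul_mul, Matrix.mul_smul, hC,
      Matrix.submatrix_mul_equiv, Matrix.submatrix_id_id, hc, smul_smul, smul_smul, hs, one_smul]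
  have hC2 (g : H) : (ρ.indBlock g).submatrix finProdFinEquiv.symm finProdFinEquiv.symm *
      (s • C) = s • C * σ.mat g := by
    rw [Matrix.mul_smul, Matrix.smul_mul, Matrix.submatrix_mul_equiv, hB]
    rfl
  exact ⟨s • C, hC1, hC2⟩

/-! ### Twists by characters and central elements -/

theorem Irreducible.twist {ρ : UnitaryRep H} (hρ : ρ.Irreducible) (χ : H →* Circle) :
    (twist χ ρ).Irreducible := by
  intro (W : Submodule ℂ (Fin ρ.dim → ℂ)) hW
  refine hρ W fun g w hw => ?_
  have h0 : ((χ g : ℂ) • ρ.mat g) *ᵥ w ∈ W := hW g w hw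
  have h1 : ρ.mat g *ᵥ w = (χ g : ℂ)⁻¹ • (((χ g : ℂ) • ρ.mat g) *ᵥ w) := by
    rw [Matrix.smul_mulVec, inv_smul_smul₀ (Circle.coe_ne_zero _)]
  rw [h1]
  exact W.smul_mem _ h0

theorem TrivialOn.eq_one_of_twist {ρ : UnitaryRep H} {χ : H →* Circle} {X : Set H}
    (hρ : ρ.TrivialOn X) (h : (UnitaryRep.twist χ ρ).TrivialOn X) {x : H} (hx : x ∈ X) :
    χ x = 1 := by
  have h1 : (χ x : ℂ) • ρ.mat x = 1 := h x hx
  rw [hρ x hx] at h1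
  exact Circle.ext (smul_one_injective ρ (by simpa using h1))

theorem twist_one (ρ : UnitaryRep H) : UnitaryRep.twist 1 ρ = ρ := by
  refine congrArg (UnitaryRep.mk ρ.dim ρ.dim_pos) (MonoidHom.ext fun g => Subtype.ext ?_)
  change ((1 : Circle) : ℂ) • ρ.mat g = ρ.mat g
  simp

theorem twist_twist (χ χ' : H →* Circle) (ρ : UnitaryRep H) :
    UnitaryRep.twist χ (UnitaryRep.twist χ' ρ) = UnitaryRep.twist (χ * χ') ρ := by
  refine congrArg (UnitaryRep.mk ρ.dim ρ.dim_pos) (MonoidHom.ext fun g => Subtype.ext ?_)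
  change (χ g : ℂ) • (χ' g : ℂ) • ρ.mat g = ((χ g * χ' g : Circle) : ℂ) • ρ.mat g
  rw [smul_smul, Circle.coe_mul]

theorem conj_twist {K : Subgroup H} [hK : K.Normal] (g : H) {χ χ' : K →* Circle}
    (hχ : ∀ x : K, χ ⟨g⁻¹ * x * g, by simpa using hK.conj_mem x x.2 g⁻¹⟩ = χ' x)
    (ρ : UnitaryRep K) :
    conj g (UnitaryRep.twist χ ρ) = UnitaryRep.twist χ' (conj g ρ) := by
  refine congrArg (UnitaryRep.mk ρ.dim ρ.dim_pos) (MonoidHom.ext fun x => Subtype.ext ?_)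
  change (conj g (UnitaryRep.twist χ ρ)).mat x = (χ' x : ℂ) • (conj g ρ).mat x
  rw [conj_mat, conj_mat, ← hχ]
  rfl

/-- Central elements act by scalars of absolute value one. -/
theorem Irreducible.mat_of_central {ρ : UnitaryRep H} (hρ : ρ.Irreducible) {z : H}
    (hz : ∀ g, g * z = z * g) : ∃ c : Circle, ρ.mat z = (c : ℂ) • 1 := by
  obtain ⟨c, hc⟩ := hρ.eq_smul_one (A := ρ.mat z) fun g => by
    rw [← mat_mul, ← mat_mul, hz]
  have h1 := ρ.mat_mul_conjTranspose z
  rw [hc, Matrix.conjTranspose_smul, smul_mul_smul_comm, Matrix.conjTranspose_one,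
    Matrix.mul_one] at h1
  have h2 : c * star c = 1 := smul_one_injective ρ (by simpa using h1)
  have h3 : ‖c‖ = 1 := by
    have h4 : (Complex.normSq c : ℂ) = 1 := by rw [← Complex.mul_conj]; exact h2
    rw [← sq_eq_sq₀ (norm_nonneg _) zero_le_one, ← Complex.normSq_eq_norm_sq, one_pow]
    exact_mod_cast h4
  exact ⟨⟨c, mem_sphere_zero_iff_norm.2 h3⟩, hc⟩

end UnitaryRep

namespace RepClass

variable {H : Type} [Group H]

theorem twist_one (c : RepClass H) : twist 1 c = c :=
  Quotient.inductionOn c fun ρ => congrArg _ ρ.twist_one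

theorem twist_twist (χ χ' : H →* Circle) (c : RepClass H) :
    twist χ (twist χ' c) = twist (χ * χ') c :=
  Quotient.inductionOn c fun ρ => congrArg _ (ρ.twist_twist χ χ')

end RepClass

/-! ### Powers of translations and characters of a lattice -/

namespace EuclideanGroup

variable {n : Type} [Fintype n] [DecidableEq n]

theorem pow_trans_of_rot_eq_one {g : EuclideanGroup n} (hg : g.rot = 1) (k : ℕ) :
    (g ^ k).trans = k • g.trans := by
  induction k with
  | zero => simp
  | succ k ih =>
    have h1 : (g ^ k).rot = 1 := by
      rw [show (g ^ k).rot = g.rot ^ k from map_pow (rotHom n) g k, hg, one_pow]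
    rw [pow_succ, mul_trans, ih, h1, succ_nsmul]
    simp

end EuclideanGroup

/-- Every character of a lattice is given by a wave vector. -/
theorem exists_dotProduct_eq_of_isZLattice {n : Type} [Fintype n] [DecidableEq n]
    (Λ : Submodule ℤ (n → ℝ)) [DiscreteTopology Λ] [IsZLattice ℝ Λ] (φ : Λ →+ Additive Circle)
    {a : ℝ} (ha : a ≠ 0) :
    ∃ k : n → ℝ, ∀ x, (φ x).toMul = Circle.exp (a * (k ⬝ᵥ (x : n → ℝ))) := by
  have hfree : Module.Free ℤ Λ := ZLattice.module_free ℝ Λ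
  let b := Module.Free.chooseBasis ℤ Λ
  let bR := b.ofZLatticeBasis ℝ Λ
  choose θ hθ using fun i => Circle.exp_surjective (φ (b i)).toMul
  -- A `ℤ`-basis of `Λ` is an `ℝ`-basis of the space, so angles `θ i` chosen freely on it, divided
  -- by `a`, extend to a linear functional; `k` is the vector representing it.
  let f : (n → ℝ) →ₗ[ℝ] ℝ := bR.constr ℝ fun i => a⁻¹ * θ i
  obtain ⟨k, hk'⟩ := (dotProductEquiv ℝ n).surjective f
  have hk : ∀ x, k ⬝ᵥ x = f x := LinearMap.congr_fun hk'
  let ψ : Λ →+ Additive Circle := AddMonoidHom.mk' (fun x => Additive.ofMul (Circle.exp (a * f x)))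
    fun x y => by simp [mul_add, Circle.exp_add]
  have hb : ∀ i, φ (b i) = ψ (b i) := by
    intro i
    have h1 : f (b i) = a⁻¹ * θ i := by
      rw [← b.ofZLatticeBasis_apply ℝ Λ i]
      exact bR.constr_basis ℝ _ i
    change φ (b i) = Additive.ofMul (Circle.exp (a * f (b i)))
    rw [h1, mul_inv_cancel_left₀ ha, hθ]
    rfl
  have h : φ.toIntLinearMap = ψ.toIntLinearMap := b.ext hb
  refine ⟨k, fun x => ?_⟩
  rw [hk]
  exact congrArg Additive.toMul (LinearMap.congr_fun h x)

/-! ### Wave vectors, conjugation and the relation `∼` -/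

namespace SectionedGroup

variable {d₁ d₂ : ℕ} (D : SectionedGroup d₁ d₂)

theorem rot_proj_of_mem_TF {g : D.G} (hg : g ∈ D.TF) : (D.proj g).rot = 1 := by
  rw [D.TF_eq_ker] at hg
  exact hg

theorem T_subset_TF {t : D.G} (ht : t ∈ D.T) : t ∈ D.TF := by
  rw [D.TF_eq_comap]
  exact D.bijOn.mapsTo ht

theorem chi_apply (k : Fin d₂ → ℝ) (g : D.TF) :
    D.chi k g = Circle.exp (2 * Real.pi * (k ⬝ᵥ (D.proj g).trans)) := rfl

theorem chi_zero : D.chi 0 = 1 := by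
  ext g
  simp [chi_apply]

theorem chi_add (k l : Fin d₂ → ℝ) : D.chi (k + l) = D.chi k * D.chi l := by
  ext1 g
  rw [MonoidHom.mul_apply, chi_apply, chi_apply, chi_apply, ← Circle.exp_add, add_dotProduct,
    mul_add]

/-- For a translation `π(x)`, conjugation by `g⁻¹` only rotates the translation vector by the
transpose of `rot (π g)`; moving the transpose across the dot product rotates `k` instead. -/
theorem chi_conj (k : Fin d₂ → ℝ) (g : D.G) (x : D.TF) (h : g⁻¹ * x * g ∈ D.TF) :
    D.chi k ⟨g⁻¹ * x * g, h⟩ = D.chi ((D.proj g).rot.1 *ᵥ k) x := by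
  rw [chi_apply, chi_apply]
  congr 2
  have h1 := D.rot_proj_of_mem_TF x.2
  have h2 : ((D.proj g).rot⁻¹).1 = (D.proj g).rot.1ᵀ := rfl
  have h3 : (D.proj (g⁻¹ * x * g)).trans = (D.proj g).rot.1ᵀ *ᵥ (D.proj x).trans := by
    rw [map_mul, map_mul, map_inv]
    simp only [EuclideanGroup.mul_trans, EuclideanGroup.mul_rot, EuclideanGroup.inv_trans,
      EuclideanGroup.inv_rot, h1, mul_one, h2]
    abel
  rw [h3, Matrix.dotProduct_mulVec, Matrix.vecMul_transpose]

theorem conj_twist_chi (g : D.G) (k : Fin d₂ → ℝ) (c : RepClass D.TF) :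
    RepClass.conj g (RepClass.twist (D.chi k) c) =
      RepClass.twist (D.chi ((D.proj g).rot.1 *ᵥ k)) (RepClass.conj g c) :=
  Quotient.inductionOn c fun ρ =>
    congrArg _ (UnitaryRep.conj_twist g (fun x => D.chi_conj k g x _) ρ)

/-- If a twist of `c` by a wave vector is related to `c'`, then `c` is related to `c'`. -/
theorem Rel.of_twist {k : Fin d₂ → ℝ} {c c' : RepClass D.TF}
    (h : D.Rel (RepClass.twist (D.chi k) c) c') : D.Rel c c' := by
  obtain ⟨g, l, h⟩ := h
  -- With `A = rot (π g)`, write `c = χ_{-k} (χ_k c)`; conjugating by `g` turns `-k` into `-A k`,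
  -- which adds to `l`.
  refine ⟨g, (D.proj g).rot.1 *ᵥ (-k) + l, ?_⟩
  rw [D.chi_add, ← RepClass.twist_twist, ← h, ← D.conj_twist_chi, RepClass.twist_twist,
    ← D.chi_add, neg_add_cancel, D.chi_zero, RepClass.twist_one]

/-! ### The central subgroup `T^m` and its characters -/

theorem eq_of_pow_eq {s t : D.G} (hs : s ∈ D.T) (ht : t ∈ D.T) {m : ℕ} (hm : 0 < m)
    (h : D.proj (s ^ m) = D.proj (t ^ m)) : s = t := by
  have hs1 := D.rot_proj_of_mem_TF (D.T_subset_TF hs)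
  have ht1 := D.rot_proj_of_mem_TF (D.T_subset_TF ht)
  refine D.bijOn.injOn hs ht (EuclideanGroup.ext (hs1.trans ht1.symm) ?_)
  have h1 := congrArg EuclideanGroup.trans h
  rw [map_pow, map_pow, EuclideanGroup.pow_trans_of_rot_eq_one hs1,
    EuclideanGroup.pow_trans_of_rot_eq_one ht1] at h1
  exact smul_right_injective _ hm.ne' h1

/-- This allows identities between elements of `T^m` to be checked on translation vectors, although
`π` has kernel `F` on `G`. -/
theorem proj_injOn_Tpow {m : ℕ} (hm : 0 < m) : Set.InjOn D.proj (D.Tpow m) := by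
  rintro _ ⟨s, hs, rfl⟩ _ ⟨t, ht, rfl⟩ h
  change s ^ m = t ^ m
  rw [D.eq_of_pow_eq hs ht hm h]

/-- The normal subgroup `T^m` is central in `T F`. -/
theorem commute_of_mem_Tpow {m : ℕ} (hm : m ∈ D.M₀) {g x : D.G} (hg : g ∈ D.TF)
    (hx : x ∈ D.Tpow m) : g * x = x * g := by
  obtain ⟨hm0, K, hK, hKT⟩ := hm
  rw [← hKT] at hx
  have h1 : g * x * g⁻¹ ∈ K := hK.conj_mem x hx g
  have hxTF : x ∈ D.TF := by
    rw [hKT] at hx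
    obtain ⟨t, ht, rfl⟩ := hx
    exact D.TF.pow_mem (D.T_subset_TF ht) m
  have hgr := D.rot_proj_of_mem_TF hg
  have hxr := D.rot_proj_of_mem_TF hxTF
  -- Translations commute, so `x` and its conjugate, which is in `T^m` by normality, have the same
  -- image.
  have h2 : D.proj (g * x * g⁻¹) = D.proj x := by
    rw [map_mul, map_mul, map_inv]
    ext1
    · simp [hgr]
    · simp [hgr, hxr]
  have h3 := D.proj_injOn_Tpow hm0 (hKT ▸ h1) (hKT ▸ hx) h2
  rwa [mul_inv_eq_iff_eq_mul] at h3

theorem span_latticeSubgroup :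
    Submodule.span ℝ (latticeSubgroup D.S : Set (Fin d₂ → ℝ)) = ⊤ := by
  obtain ⟨-, t, ht, hli⟩ := D.isSpaceGroup
  rw [eq_top_iff, ← hli.span_eq_top_of_card_eq_finrank' (by simp)]
  refine Submodule.span_mono ?_
  rintro _ ⟨i, rfl⟩
  have h1 : (t i).rot = 1 := (ht i).2
  have e : (⟨1, (t i).trans⟩ : EuclideanGroup (Fin d₂)) = t i := EuclideanGroup.ext h1.symm rfl
  change (⟨1, (t i).trans⟩ : EuclideanGroup (Fin d₂)) ∈ D.S
  rw [e]
  exact (ht i).1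

/-- Every character of the lattice of translations is given by a wave vector. -/
theorem exists_dotProduct_eq (φ : latticeSubgroup D.S →+ Additive Circle) {a : ℝ} (ha : a ≠ 0) :
    ∃ k : Fin d₂ → ℝ, ∀ x, (φ x).toMul = Circle.exp (a * (k ⬝ᵥ (x : Fin d₂ → ℝ))) :=
  have : DiscreteTopology (latticeSubgroup D.S).toIntSubmodule :=
    latticeSubgroup_discrete D.isSpaceGroup.1
  have : IsZLattice ℝ (latticeSubgroup D.S).toIntSubmodule :=
    ⟨D.span_latticeSubgroup⟩
  exists_dotProduct_eq_of_isZLattice (latticeSubgroup D.S).toIntSubmodule φ ha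

/-- Every irreducible representation of `T F` becomes trivial on `T^m` after multiplication by a
suitable character `χ_k`. -/
theorem exists_twist_trivialOn {m : ℕ} (hm : m ∈ D.M₀) {τ : UnitaryRep D.TF}
    (hτ : τ.Irreducible) :
    ∃ k, (UnitaryRep.twist (D.chi k) τ).TrivialOn (Subtype.val ⁻¹' D.Tpow m) := by
  have hm0 := hm.1
  have hs : ∀ x : latticeSubgroup D.S, ∃ s ∈ D.T, D.proj s = ⟨1, x⟩ := fun x =>
    D.bijOn.surjOn (show (⟨1, x⟩ : EuclideanGroup (Fin d₂)) ∈ _ from ⟨x.2, rfl⟩)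
  choose s hsT hs using hs
  have hz : ∀ x, s x ^ m ∈ D.TF := fun x => D.TF.pow_mem (D.T_subset_TF (hsT x)) m
  have htrans : ∀ x, (D.proj (s x ^ m)).trans = m • (x : Fin d₂ → ℝ) := fun x => by
    rw [map_pow, EuclideanGroup.pow_trans_of_rot_eq_one (by rw [hs]), hs]
  have hc : ∀ x, ∃ c : Circle, τ.mat ⟨s x ^ m, hz x⟩ = (c : ℂ) • 1 := fun x =>
    hτ.mat_of_central fun g =>
      Subtype.ext (D.commute_of_mem_Tpow hm g.2 ⟨s x, hsT x, rfl⟩)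
  choose c hc using hc
  -- The section `s` need not be additive, but its `m`-th power is: both sides lie in the subgroup
  -- `T^m` and project to the translation by `m (x + y)`.
  have hadd : ∀ x y, s (x + y) ^ m = s x ^ m * s y ^ m := by
    intro x y
    obtain ⟨-, K, hK, hKT⟩ := hm
    have hmem : ∀ x, s x ^ m ∈ K := fun x => by
      have : s x ^ m ∈ D.Tpow m := ⟨s x, hsT x, rfl⟩
      rwa [← hKT] at this
    refine D.proj_injOn_Tpow hm0 ⟨_, hsT _, rfl⟩ ?_ ?_
    · rw [← hKT]
      exact K.mul_mem (hmem x) (hmem y)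
    · refine EuclideanGroup.ext ?_ ?_
      · rw [D.rot_proj_of_mem_TF (hz _), D.rot_proj_of_mem_TF (D.TF.mul_mem (hz x) (hz y))]
      · rw [htrans, map_mul, EuclideanGroup.mul_trans, htrans, htrans,
          D.rot_proj_of_mem_TF (hz x)]
        simp
  have hcadd : ∀ x y, c (x + y) = c x * c y := by
    intro x y
    refine Circle.ext (UnitaryRep.smul_one_injective τ ?_)
    change (c (x + y) : ℂ) • (1 : Matrix _ _ ℂ) = ((c x * c y : Circle) : ℂ) • 1
    have h1 : (⟨s (x + y) ^ m, hz _⟩ : D.TF) = ⟨s x ^ m, hz x⟩ * ⟨s y ^ m, hz y⟩ :=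
      Subtype.ext (hadd x y)
    rw [← hc, h1, UnitaryRep.mat_mul, hc, hc, smul_mul_smul_comm, Matrix.mul_one,
      Circle.coe_mul]
  let φ : latticeSubgroup D.S →+ Additive Circle :=
    AddMonoidHom.mk' (fun x => Additive.ofMul (c x)) hcadd
  -- The factor `m` appears because `s x ^ m` translates by `m x`; the sign makes `χ_k` cancel the
  -- scalar `c x`.
  have ha : (-(2 * Real.pi * m) : ℝ) ≠ 0 :=
    neg_ne_zero.2 (mul_ne_zero Real.two_pi_pos.ne' (Nat.cast_ne_zero.2 hm0.ne'))
  obtain ⟨k, hk⟩ := D.exists_dotProduct_eq φ ha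
  refine ⟨k, ?_⟩
  rintro ⟨_, hTF⟩ ⟨t, ht, rfl⟩
  have htr := D.rot_proj_of_mem_TF (D.T_subset_TF ht)
  have htS : (⟨1, (D.proj t).trans⟩ : EuclideanGroup (Fin d₂)) = D.proj t :=
    EuclideanGroup.ext htr.symm rfl
  let x : latticeSubgroup D.S := ⟨(D.proj t).trans, by
    change (⟨1, (D.proj t).trans⟩ : EuclideanGroup (Fin d₂)) ∈ D.S
    rw [htS]
    exact D.proj_mem t⟩
  have hst : s x = t := D.bijOn.injOn (hsT x) ht ((hs x).trans htS)
  have e : (⟨t ^ m, hTF⟩ : D.TF) = ⟨s x ^ m, hz x⟩ := Subtype.ext (by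
    change t ^ m = s x ^ m
    rw [hst])
  change (D.chi k ⟨t ^ m, hTF⟩ : ℂ) • τ.mat ⟨t ^ m, hTF⟩ = 1
  rw [e, hc, smul_smul, ← Circle.coe_mul, show c x = _ from hk x, chi_apply, ← Circle.exp_add,
    htrans, dotProduct_smul, nsmul_eq_mul]
  have h0 : 2 * Real.pi * (m * (k ⬝ᵥ (x : Fin d₂ → ℝ))) +
      -(2 * Real.pi * m) * (k ⬝ᵥ (x : Fin d₂ → ℝ)) = 0 := by ring
  rw [h0]
  simp

theorem Tpow_mul_subset {m j : ℕ} (hm : m ∈ D.M₀) : D.Tpow (m * j) ⊆ D.Tpow m := by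
  obtain ⟨-, K, -, hKT⟩ := hm
  rintro _ ⟨t, ht, rfl⟩
  have h1 : t ^ m ∈ K := by
    have : t ^ m ∈ D.Tpow m := ⟨t, ht, rfl⟩
    rwa [← hKT] at this
  rw [← hKT]
  change t ^ (m * j) ∈ K
  rw [pow_mul]
  exact K.pow_mem h1 j

/-- For `t ∈ T` translating by `y`, `χ_k(t^N) = exp(2πi N⟨k, y⟩)`, and `y` runs through all of `L`.
-/
theorem mem_LdualDiv {N : ℕ} (hN : 0 < N) {k : Fin d₂ → ℝ}
    (h : ∀ x : D.TF, (x : D.G) ∈ D.Tpow N → D.chi k x = 1) : k ∈ D.LdualDiv N := by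
  have hN' : (N : ℝ) ≠ 0 := Nat.cast_ne_zero.2 hN.ne'
  refine ⟨(N : ℝ) • k, ?_, inv_smul_smul₀ hN' k⟩
  rintro _ ⟨y, hy, rfl⟩
  obtain ⟨t, ht, rfl⟩ := D.bijOn.surjOn hy
  have htTF := D.T_subset_TF ht
  have h1 := h ⟨t ^ N, D.TF.pow_mem htTF N⟩ ⟨t, ht, rfl⟩
  rw [chi_apply, map_pow, EuclideanGroup.pow_trans_of_rot_eq_one (D.rot_proj_of_mem_TF htTF),
    Circle.exp_eq_one] at h1
  obtain ⟨z, hz⟩ := h1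
  refine ⟨z, ?_⟩
  change ((N : ℝ) • k) ⬝ᵥ (D.proj t).trans = z
  rw [smul_dotProduct, smul_eq_mul]
  rw [dotProduct_smul, nsmul_eq_mul, mul_comm (z : ℝ)] at hz
  exact mul_left_cancel₀ Real.two_pi_pos.ne' hz

/-! ### Clifford theory and the theorem -/

/-- If `τ` is contained in the restriction of the irreducible representation `σ` and `ρ` is
related to `τ`, then `χ_k ρ` is contained in the restriction of `σ` and `σ` is contained in the
representation induced by `χ_k ρ`, for some `k`. -/
theorem exists_isSubrep_of_rel {σ : UnitaryRep D.G} (hσ : σ.Irreducible) {τ ρ : UnitaryRep D.TF}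
    (hτ : τ.IsSubrep (UnitaryRep.res D.TF σ)) (h : D.Rel ⟦τ⟧ ⟦ρ⟧) :
    ∃ k, (UnitaryRep.twist (D.chi k) ρ).IsSubrep (UnitaryRep.res D.TF σ) ∧
      σ.IsSubrep (UnitaryRep.twist (D.chi k) ρ).ind := by
  obtain ⟨g, k, h⟩ := h
  have h1 : UnitaryRep.Equivalent (UnitaryRep.conj g τ) (UnitaryRep.twist (D.chi k) ρ) :=
    Quotient.exact h
  have h2 := (hτ.conj_res g).congr h1 (UnitaryRep.Equivalent.refl _)
  exact ⟨k, h2, hσ.isSubrep_ind h2⟩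

end SectionedGroup

theorem mainTheorem8 {d₁ d₂ : ℕ} (D : SectionedGroup d₁ d₂) :
    (∀ R : Set (RepClass D.TF), IsRepresentationSet D.Rel (dualSpace D.TF) R →
      ∀ σ ∈ dualSpace D.G, ∃ ρ ∈ R, ∃ k : Fin d₂ → ℝ,
        σ.IsSubrep (RepClass.ind (RepClass.twist (D.chi k) ρ))) ∧
    (∀ m : ℕ, D.M₀ = {n | ∃ j : ℕ, 0 < j ∧ n = m * j} →
      ∀ R : Set (RepClass D.TF),
        IsRepresentationSet D.Rel
          {ρ | ρ ∈ dualSpace D.TF ∧ ρ.TrivialOn (Subtype.val ⁻¹' D.Tpow m)} R →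
        ∀ σ ∈ dualSpace D.G, ∀ N ∈ D.M₀, σ.TrivialOn (D.Tpow N) →
          ∃ ρ ∈ R, ∃ k ∈ D.LdualDiv N,
            σ.IsSubrep (RepClass.ind (RepClass.twist (D.chi k) ρ))) := by
  refine ⟨fun R hR σ hσ => ?_, fun m hM R hR σ hσ N hN hσN => ?_⟩
  · induction σ using Quotient.inductionOn with | _ σ
    obtain ⟨τ, hτ, hτσ⟩ := (UnitaryRep.res D.TF σ).exists_irreducible_isSubrep
    obtain ⟨ρ, ⟨hρR, hrel⟩, -⟩ := hR.2 ⟦τ⟧ hτ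
    induction ρ using Quotient.inductionOn with | _ ρ
    obtain ⟨k, -, hk⟩ := D.exists_isSubrep_of_rel hσ hτσ hrel
    exact ⟨_, hρR, k, hk⟩
  · induction σ using Quotient.inductionOn with | _ σ
    have hm : m ∈ D.M₀ := by
      rw [hM]
      exact ⟨1, one_pos, (mul_one m).symm⟩
    obtain ⟨τ, hτ, hτσ⟩ := (UnitaryRep.res D.TF σ).exists_irreducible_isSubrep
    -- `τ` itself need not be trivial on `T^m`; its twist by `χ_l` is, and so has a representative
    -- in `R`.
    obtain ⟨l, hl⟩ := D.exists_twist_trivialOn hm hτ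
    obtain ⟨ρ, ⟨hρR, hrel⟩, -⟩ :=
      hR.2 (RepClass.twist (D.chi l) ⟦τ⟧) ⟨hτ.twist (D.chi l), hl⟩
    have hρ := (hR.1 hρR).2
    induction ρ using Quotient.inductionOn with | _ ρ
    obtain ⟨k, hkσ, hk⟩ :=
      D.exists_isSubrep_of_rel hσ hτσ (SectionedGroup.Rel.of_twist D hrel)
    refine ⟨_, hρR, k, D.mem_LdualDiv hN.1 ?_, hk⟩
    have hN' := hN
    rw [hM] at hN'
    obtain ⟨j, -, rfl⟩ := hN'
    -- `ρ` and `χ_k ρ` are both trivial on `T^N`, so their quotient `χ_k` is too.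
    have hρN : ρ.TrivialOn (Subtype.val ⁻¹' D.Tpow (m * j)) := fun x hx =>
      hρ x (D.Tpow_mul_subset hm hx)
    have hσN' : (UnitaryRep.res D.TF σ).TrivialOn (Subtype.val ⁻¹' D.Tpow (m * j)) :=
      fun x hx => hσN x hx
    exact fun x hx => hρN.eq_one_of_twist (hkσ.trivialOn hσN') hx
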